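/- Let $X$ be a completely regular Hausdorff space and let $C(X)$ be the set of all real-valued continuous functions on $X$. The $U$-topology on $C(X)$ is the topology with open base consisting of the sets $\{g\in C(X):\sup_{x\in X}|f(x)-g(x)|<\epsilon\}$, where $f\in C(X)$ and $\epsilon>0$. The $m$-topology on $C(X)$ is the topology with open base consisting of the sets $\{g\in C(X):|f(x)-g(x)|<u(x)\text{ for all }x\in X\}$, where $f,u\in C(X)$ and $u(x)>0$ for all $x\in X$. An ideal of closed sets in $X$ is a family $\mathcal P$ of closed subsets of $X$ such that $E\cup F\in\mathcal P$ whenever $E,F\in\mathcal P$, and $C\in\mathcal P$ whenever $C$ is a closed subset of $X$ contained in some $E\in\mathcal P$. For such $\mathcal P$ put $$C_{\mathcal P}(X)=\{f\in C(X): \overline{\{x\in X: f(x)\neq 0\}}\in\mathcal P\},$$ $$C^{\mathcal P}_\infty(X)=\{f\in C(X): \{x\in X:|f(x)|\ge \tfrac1n\}\in\mathcal P\text{ for every integer }n\ge 1\}.$$ Then: 1. The $U$-topology and the $m$-topology on $C(X)$ are equal if and only if, for every ideal $\mathcal P$ of closed sets in $X$, the closure of $C_{\mathcal P}(X)$ in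 the $U$-topology equals the closure of $C_{\mathcal P}(X)$ in the $m$-topology. 2. $X$ is pseudocompact (that is, every real-valued continuous function on $X$ is bounded) if and only if, for every ideal $\mathcal P$ of closed sets in $X$, $C_{\mathcal P}(X)$ is a dense subset of $C^{\mathcal P}_\infty(X)$ with respect to the $m$-topology. -/

import Mathlib

open Topology

namespace FunctionSpace

variable {X : Type*} [TopologicalSpace X]

/-- The basic neighbourhood `{g ∈ C(X) : sup_{x ∈ X} |f(x) - g(x)| < ε}`. The supremum is taken in
the extended reals, so that it is `+∞` if `f - g` is unbounded. -/
def uBall (f : C(X, ℝ)) (ε : ℝ) : Set C(X, ℝ) :=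
  {g | (⨆ x : X, ((|f x - g x| : ℝ) : EReal)) < (ε : EReal)}

/-- The basic neighbourhood `{g ∈ C(X) : |f(x) - g(x)| < u(x) for all x ∈ X}`. -/
def mBall (f u : C(X, ℝ)) : Set C(X, ℝ) :=
  {g | ∀ x : X, |f x - g x| < u x}

variable (X) in
/-- The open base of the `U`-topology: all `uBall f ε` with `ε > 0`. -/
def uBase : Set (Set C(X, ℝ)) :=
  {B | ∃ (f : C(X, ℝ)) (ε : ℝ), 0 < ε ∧ B = uBall f ε}

variable (X) in
/-- The open base of the `m`-topology: all `mBall f u` with `u` a positive unit of `C(X)`, that is,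
a continuous function which is strictly positive on `X`. -/
def mBase : Set (Set C(X, ℝ)) :=
  {B | ∃ f u : C(X, ℝ), (∀ x, 0 < u x) ∧ B = mBall f u}

variable (X) in
/-- The `U`-topology (topology of uniform convergence) on `C(X)`. -/
@[reducible] def uTopology : TopologicalSpace C(X, ℝ) := TopologicalSpace.generateFrom (uBase X)

variable (X) in
/-- The `m`-topology on `C(X)`. -/
@[reducible] def mTopology : TopologicalSpace C(X, ℝ) := TopologicalSpace.generateFrom (mBase X)

theorem mem_uBall_iff {f g : C(X, ℝ)} {ε : ℝ} :
    g ∈ uBall f ε ↔ ∃ δ < ε, ∀ x, |f x - g x| ≤ δ := by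
  constructor
  · intro h
    obtain ⟨δ, h1, h2⟩ := EReal.lt_iff_exists_real_btwn.1 (show _ < _ from h)
    exact ⟨δ, EReal.coe_lt_coe_iff.1 h2, fun x =>
      EReal.coe_le_coe_iff.1 ((le_iSup (fun x : X => ((|f x - g x| : ℝ) : EReal)) x).trans h1.le)⟩
  · rintro ⟨δ, h1, h2⟩
    exact (iSup_le fun x => EReal.coe_le_coe_iff.2 (h2 x)).trans_lt (EReal.coe_lt_coe_iff.2 h1)

/-- The sets `uBall f ε`, `ε > 0`, form an open base (not just a subbase) of the `U`-topology. -/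
theorem isTopologicalBasis_uBase :
    @TopologicalSpace.IsTopologicalBasis _ (uTopology X) (uBase X) := by
  have key : ∀ (f g : C(X, ℝ)) (ε : ℝ), g ∈ uBall f ε → ∃ η > 0, uBall g η ⊆ uBall f ε := by
    intro f g ε h
    obtain ⟨δ, h1, h2⟩ := mem_uBall_iff.1 h
    refine ⟨ε - δ, sub_pos.2 h1, fun k hk => ?_⟩
    obtain ⟨δ', h3, h4⟩ := mem_uBall_iff.1 hk
    exact mem_uBall_iff.2 ⟨δ + δ', by linarith, fun x =>
      (abs_sub_le (f x) (g x) (k x)).trans (add_le_add (h2 x) (h4 x))⟩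
  let := uTopology X
  refine ⟨?_, ?_, rfl⟩
  · rintro _ ⟨f₁, ε₁, _, rfl⟩ _ ⟨f₂, ε₂, _, rfl⟩ g ⟨hg₁, hg₂⟩
    obtain ⟨η₁, hη₁, hs₁⟩ := key _ _ _ hg₁
    obtain ⟨η₂, hη₂, hs₂⟩ := key _ _ _ hg₂
    refine ⟨_, ⟨g, min η₁ η₂, lt_min hη₁ hη₂, rfl⟩,
      mem_uBall_iff.2 ⟨0, lt_min hη₁ hη₂, by simp⟩, fun k hk => ?_⟩
    obtain ⟨δ, h1, h2⟩ := mem_uBall_iff.1 hk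
    exact ⟨hs₁ (mem_uBall_iff.2 ⟨δ, h1.trans_le (min_le_left _ _), h2⟩),
      hs₂ (mem_uBall_iff.2 ⟨δ, h1.trans_le (min_le_right _ _), h2⟩)⟩
  · exact Set.eq_univ_of_forall fun f =>
      ⟨_, ⟨f, 1, one_pos, rfl⟩, mem_uBall_iff.2 ⟨0, one_pos, by simp⟩⟩

/-- The sets `mBall f u`, `u` a positive unit, form an open base of the `m`-topology. -/
theorem isTopologicalBasis_mBase :
    @TopologicalSpace.IsTopologicalBasis _ (mTopology X) (mBase X) := by
  let := mTopology X
  refine ⟨?_, ?_, rfl⟩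
  · rintro _ ⟨f₁, u₁, _, rfl⟩ _ ⟨f₂, u₂, _, rfl⟩ g ⟨hg₁, hg₂⟩
    let v : C(X, ℝ) := ⟨fun x => min (u₁ x - |f₁ x - g x|) (u₂ x - |f₂ x - g x|), by fun_prop⟩
    have hv : ∀ x, 0 < v x := fun x => lt_min (sub_pos.2 (hg₁ x)) (sub_pos.2 (hg₂ x))
    refine ⟨_, ⟨g, v, hv, rfl⟩, fun x => by simpa using hv x, fun k hk => ⟨fun x => ?_, fun x => ?_⟩⟩
    · have h := (hk x).trans_le (min_le_left _ _)
      have := abs_sub_le (f₁ x) (g x) (k x)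
      linarith
    · have h := (hk x).trans_le (min_le_right _ _)
      have := abs_sub_le (f₂ x) (g x) (k x)
      linarith
  · exact Set.eq_univ_of_forall fun f => ⟨_, ⟨f, 1, fun _ => one_pos, rfl⟩, fun x => by simp⟩

/-- `P` is an ideal of closed sets in `X`: a family of closed subsets of `X` which is closed under
binary unions and under passing to closed subsets. -/
structure IsIdealOfClosedSets (P : Set (Set X)) : Prop where
  isClosed : ∀ E ∈ P, IsClosed E
  union_mem : ∀ E ∈ P, ∀ F ∈ P, E ∪ F ∈ P
  mem_of_subset : ∀ E ∈ P, ∀ C : Set X, IsClosed C → C ⊆ E → C ∈ P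

/-- `C_P(X)`: the functions in `C(X)` whose support `cl_X (X \ Z(f))` belongs to `P`. -/
def supportedIn (P : Set (Set X)) : Set C(X, ℝ) :=
  {f | tsupport f ∈ P}

/-- `C_∞^P(X)`: the functions `f ∈ C(X)` such that `{x : |f(x)| ≥ 1/n} ∈ P` for every positive
integer `n`. -/
def vanishingAtInfinity (P : Set (Set X)) : Set C(X, ℝ) :=
  {f | ∀ n : ℕ, 0 < n → {x : X | 1 / (n : ℝ) ≤ |f x|} ∈ P}

variable (X) in
/-- `X` is pseudocompact: every continuous real-valued function on `X` is bounded. -/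
def IsPseudocompact : Prop :=
  ∀ f : C(X, ℝ), ∃ M : ℝ, ∀ x, |f x| ≤ M

/-- `A` is a dense subset of the set `B` with respect to the topology `t`. -/
def IsDenseIn {Y : Type*} (t : TopologicalSpace Y) (A B : Set Y) : Prop :=
  A ⊆ B ∧ B ⊆ closure[t] A

end FunctionSpace

namespace FunctionSpace

variable {X : Type*} [TopologicalSpace X]

/-! Both conditions are equivalent to pseudocompactness. If `X` is pseudocompact, positive
continuous functions are bounded away from zero, so the two topologies agree. For every ideal `P`,
truncation puts `vanishingAtInfinity P` inside the `U`-closure of `supportedIn P`; hence either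
condition on closures puts it inside the `m`-closure. An unbounded `f` refutes this: take for `P`
the closed sets on which `|f|` is bounded and consider `1 / (1 + |f|)`. -/

variable (X) in
/-- The `m`-topology is finer than the `U`-topology. -/
theorem mTopology_le_uTopology : mTopology X ≤ uTopology X := by
  refine le_generateFrom ?_
  rintro _ ⟨f, ε, -, rfl⟩
  let := mTopology X
  refine isTopologicalBasis_mBase.isOpen_iff.2 fun g hg => ?_
  obtain ⟨δ, h1, h2⟩ := mem_uBall_iff.1 hg
  -- Halving matters: a strict pointwise bound gives only a weak bound on the supremum.
  have hpos : 0 < (ε - δ) / 2 := by linarith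
  refine ⟨_, ⟨g, ContinuousMap.const X ((ε - δ) / 2), fun _ => hpos, rfl⟩,
    fun x => by simpa using hpos, fun k hk => ?_⟩
  refine mem_uBall_iff.2 ⟨δ + (ε - δ) / 2, by linarith, fun x => ?_⟩
  have h3 : |g x - k x| < (ε - δ) / 2 := hk x
  exact (abs_sub_le (f x) (g x) (k x)).trans (add_le_add (h2 x) h3.le)

/-- On a pseudocompact space every positive continuous function is bounded away from zero. -/
theorem IsPseudocompact.exists_pos_le (h : IsPseudocompact X) {v : C(X, ℝ)} (hv : ∀ x, 0 < v x) :
    ∃ δ > 0, ∀ x, δ ≤ v x := by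
  obtain ⟨M, hM⟩ := h ⟨fun x => (v x)⁻¹, v.continuous.inv₀ fun x => (hv x).ne'⟩
  -- `M` may be nonpositive when `X` is empty.
  have hpos : 0 < max M 1 := lt_max_of_lt_right one_pos
  refine ⟨(max M 1)⁻¹, inv_pos.2 hpos, fun x => ?_⟩
  exact inv_le_of_inv_le₀ (hv x) (((le_abs_self _).trans (hM x)).trans (le_max_left _ _))

/-- On a pseudocompact space the `U`-topology and the `m`-topology coincide. -/
theorem IsPseudocompact.uTopology_eq_mTopology (h : IsPseudocompact X) :
    uTopology X = mTopology X := by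
  refine le_antisymm (le_generateFrom ?_) (mTopology_le_uTopology X)
  rintro _ ⟨f, u, -, rfl⟩
  let := uTopology X
  refine isTopologicalBasis_uBase.isOpen_iff.2 fun g hg => ?_
  let v : C(X, ℝ) := ⟨fun x => u x - |f x - g x|, by fun_prop⟩
  obtain ⟨δ, hδ, hle⟩ := h.exists_pos_le (v := v) fun x => sub_pos.2 (hg x)
  refine ⟨_, ⟨g, δ, hδ, rfl⟩, mem_uBall_iff.2 ⟨0, hδ, by simp⟩, fun k hk x => ?_⟩
  obtain ⟨η, h1, h2⟩ := mem_uBall_iff.1 hk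
  have h3 : δ ≤ u x - |f x - g x| := hle x
  have h4 := abs_sub_le (f x) (g x) (k x)
  have h5 := h2 x
  linarith

theorem IsIdealOfClosedSets.supportedIn_subset {P : Set (Set X)} (hP : IsIdealOfClosedSets P) :
    supportedIn P ⊆ vanishingAtInfinity P := by
  intro f hf n hn
  refine hP.mem_of_subset _ hf _ (isClosed_le continuous_const (by fun_prop)) fun x hx => ?_
  refine subset_tsupport f fun h0 => ?_
  have h1 : 1 / (n : ℝ) ≤ |f x| := hx
  have h2 : 0 < 1 / (n : ℝ) := by positivity
  rw [h0, abs_zero] at h1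
  linarith

/-- Subtracting from `g` its truncation to `[-c, c]` moves it by at most `c`, and the result is zero
wherever `|g| < c`. Its support thus lies in the closed set `{c ≤ |g|}`, a member of `P` for `c = 1
/ (n + 1)`. -/
theorem IsIdealOfClosedSets.vanishingAtInfinity_subset {P : Set (Set X)}
    (hP : IsIdealOfClosedSets P) :
    vanishingAtInfinity P ⊆ closure[uTopology X] (supportedIn P) := by
  intro g hg
  let := uTopology X
  refine isTopologicalBasis_uBase.mem_closure_iff.2 ?_
  rintro _ ⟨f, ε, -, rfl⟩ hgf
  obtain ⟨δ, h1, h2⟩ := mem_uBall_iff.1 hgf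
  obtain ⟨n, hn⟩ := exists_nat_one_div_lt (sub_pos.2 h1)
  have hc : 0 < 1 / ((n : ℝ) + 1) := by positivity
  set c := 1 / ((n : ℝ) + 1) with hcdef
  let h : C(X, ℝ) := ⟨fun x => g x - max (-c) (min c (g x)), by fun_prop⟩
  refine ⟨h, mem_uBall_iff.2 ⟨δ + c, by linarith, fun x => ?_⟩, ?_⟩
  · have h3 : |g x - h x| ≤ c := by
      have : g x - h x = max (-c) (min c (g x)) := sub_sub_cancel _ _
      rw [this, abs_le]
      exact ⟨le_max_left _ _, max_le (by linarith) (min_le_left _ _)⟩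
    exact (abs_sub_le (f x) (g x) (h x)).trans (add_le_add (h2 x) h3)
  · have hmem : {x | c ≤ |g x|} ∈ P := by simpa [hcdef] using hg (n + 1) n.succ_pos
    refine hP.mem_of_subset _ hmem _ (isClosed_tsupport _)
      (closure_minimal (fun x hx => ?_) (hP.isClosed _ hmem))
    by_contra hlt
    obtain ⟨h3, h4⟩ := abs_lt.1 (show |g x| < c from lt_of_not_ge fun hle => hlt hle)
    refine hx ?_
    change g x - max (-c) (min c (g x)) = 0
    rw [min_eq_right h4.le, max_eq_right h3.le, sub_self]

/-- The closed sets on which a given function is bounded above form an ideal of closed sets. -/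
theorem isIdealOfClosedSets_bddAbove_image (f : X → ℝ) :
    IsIdealOfClosedSets {E : Set X | IsClosed E ∧ BddAbove (f '' E)} where
  isClosed _ hE := hE.1
  union_mem E hE F hF := ⟨hE.1.union hF.1, by
    rw [Set.image_union]
    exact hE.2.union hF.2⟩
  mem_of_subset _ hE _ hC hCE := ⟨hC, hE.2.mono (Set.image_mono hCE)⟩

/-- A function `h` in the `m`-neighbourhood `mBall g g` of a positive function `g` is positive,
hence has full support. -/
theorem notMem_closure_supportedIn {P : Set (Set X)} {g : C(X, ℝ)} (hg : ∀ x, 0 < g x)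
    (hP : Set.univ ∉ P) : g ∉ closure[mTopology X] (supportedIn P) := by
  intro hcl
  let := mTopology X
  obtain ⟨h, h1, h2⟩ := isTopologicalBasis_mBase.mem_closure_iff.1 hcl _ ⟨g, g, hg, rfl⟩
    fun x => by simpa using hg x
  refine hP ?_
  have huniv : tsupport h = Set.univ := Set.eq_univ_of_forall fun x => by
    refine subset_tsupport h fun h0 => ?_
    have h3 : |g x - h x| < g x := h1 x
    rw [h0, sub_zero] at h3
    exact (le_abs_self _).not_gt h3
  exact huniv ▸ h2

/-- If `X` is not pseudocompact, then some `C_P(X)` is not `m`-dense in `C_∞^P(X)`. -/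
theorem isPseudocompact_of_forall_vanishingAtInfinity_subset
    (h : ∀ P : Set (Set X), IsIdealOfClosedSets P →
      vanishingAtInfinity P ⊆ closure[mTopology X] (supportedIn P)) :
    IsPseudocompact X := by
  intro f
  by_contra hf
  have hpos : ∀ x, 0 < 1 + |f x| := fun x => by positivity
  let g : C(X, ℝ) := ⟨fun x => (1 + |f x|)⁻¹,
    (by fun_prop : Continuous fun x => 1 + |f x|).inv₀ fun x => (hpos x).ne'⟩
  have hg : ∀ x, 0 < g x := fun x => inv_pos.2 (hpos x)
  have hP := isIdealOfClosedSets_bddAbove_image fun x => |f x|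
  -- `X` is not in the ideal since `f` is unbounded, while `1 / n ≤ g` forces `|f| ≤ n - 1`.
  refine notMem_closure_supportedIn hg ?_ (h _ hP fun n hn => ⟨?_, n, ?_⟩)
  · rintro ⟨-, M, hM⟩
    exact hf ⟨M, fun x => hM ⟨x, trivial, rfl⟩⟩
  · exact isClosed_le continuous_const (by fun_prop)
  · rintro _ ⟨x, hx, rfl⟩
    have h1 : 1 / (n : ℝ) ≤ |g x| := hx
    have hn' : (0 : ℝ) < n := Nat.cast_pos.2 hn
    rw [abs_of_pos (hg x), one_div] at h1
    have h2 : 1 + |f x| ≤ n := (inv_le_inv₀ hn' (hpos x)).1 h1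
    change |f x| ≤ n
    linarith

end FunctionSpace

theorem mainTheorem12 {X : Type*} [TopologicalSpace X] [T35Space X] :
    (FunctionSpace.uTopology X = FunctionSpace.mTopology X ↔
      ∀ P : Set (Set X), FunctionSpace.IsIdealOfClosedSets P →
        closure[FunctionSpace.uTopology X] (FunctionSpace.supportedIn P) =
          closure[FunctionSpace.mTopology X] (FunctionSpace.supportedIn P)) ∧
    (FunctionSpace.IsPseudocompact X ↔
      ∀ P : Set (Set X), FunctionSpace.IsIdealOfClosedSets P →
        FunctionSpace.IsDenseIn (FunctionSpace.mTopology X)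
          (FunctionSpace.supportedIn P) (FunctionSpace.vanishingAtInfinity P)) := by
  refine ⟨⟨fun h P _ => by rw [h], fun h => ?_⟩, fun h P hP => ⟨hP.supportedIn_subset, ?_⟩,
    fun h => ?_⟩
  · refine FunctionSpace.IsPseudocompact.uTopology_eq_mTopology
      (FunctionSpace.isPseudocompact_of_forall_vanishingAtInfinity_subset fun P hP => ?_)
    rw [← h P hP]
    exact hP.vanishingAtInfinity_subset
  · rw [← h.uTopology_eq_mTopology]
    exact hP.vanishingAtInfinity_subset
  · exact FunctionSpace.isPseudocompact_of_forall_vanishingAtInfinity_subset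
      fun P hP => (h P hP).2
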